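/- Let $n\ge 2$ be an even integer, $\ell$ a prime, $K/\mathbb{Q}$ a finite Galois extension, and $t$ and $N$ positive integers. Then there exist primes $p$ and $q$ with the following properties: \begin{enumerate} \item The primes $p$, $q$, and $\ell$ are all distinct. \item The prime $p$ is greater than $N$. \item The prime $q$ splits completely in $K$ (every prime of the ring of integers of $K$ above $q$ has ramification index $1$ and residue degree $1$). \item The image of $q$ in $\mathbb{F}_p$ is nonzero, and its order in $\mathbb{F}_p^\times$ is exactly $n$. \item If $\mathbb{F}$ is any finite field of characteristic $\ell$ such that the group $\mathrm{GSp}_n(\mathbb{F})$ contains an element of order $p$, then $\mathbb{F}$ contains a subfield isomorphic to $\mathbb{F}_{\ell^t}$. \end{enumerate} Here $\mathrm{GSp}_n(\mathbb{F})$ is the group of symplectic similitudes: the matrices $A\in\mathrm{GL}_n(\mathbb{F})$ such that $A J A^{\mathsf T}=cJ$ for some $c\in\mathbb{F}^\times$, where $J=\begin{pmatrix}0&-I_{n/2}\\ I_{n/2}&0\end{pmatrix}$. -/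

import Mathlib

/-- The symplectic similitude group `GSp_{2m}(R)`, with `m = |l|`: the invertible matrices `A`
such that `A * J * Aᵀ = c • J` for some unit `c` of `R` (the multiplier), where `J` is the
standard alternating form. For `c = 1` this is the condition in `Matrix.symplecticGroup l R`. -/
def GSp (l : Type*) [DecidableEq l] [Fintype l] (R : Type*) [CommRing R] :
    Subgroup (GL (l ⊕ l) R) where
  carrier := {A | ∃ c : Rˣ, A.val * Matrix.J l R * A.val.transpose = (c : R) • Matrix.J l R}
  one_mem' := ⟨1, by simp⟩
  mul_mem' := by
    rintro A B ⟨c, hc⟩ ⟨d, hd⟩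
    refine ⟨c * d, ?_⟩
    calc (A * B).val * Matrix.J l R * (A * B).val.transpose
        = A.val * (B.val * Matrix.J l R * B.val.transpose) * A.val.transpose := by
          simp only [Units.val_mul, Matrix.transpose_mul, Matrix.mul_assoc]
      _ = ((c * d : Rˣ) : R) • Matrix.J l R := by
          rw [hd, Matrix.mul_smul, Matrix.smul_mul, hc, smul_smul, Units.val_mul, mul_comm]
  inv_mem' := by
    rintro A ⟨c, hc⟩
    refine ⟨c⁻¹, ?_⟩
    have h1 : A⁻¹.val * A.val = 1 := by rw [← Units.val_mul, inv_mul_cancel, Units.val_one]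
    have h2 : A.val.transpose * A⁻¹.val.transpose = 1 := by
      rw [← Matrix.transpose_mul, h1, Matrix.transpose_one]
    have h3 : (c : R) • (A⁻¹.val * Matrix.J l R * A⁻¹.val.transpose) = Matrix.J l R := by
      calc (c : R) • (A⁻¹.val * Matrix.J l R * A⁻¹.val.transpose)
          = A⁻¹.val * ((c : R) • Matrix.J l R) * A⁻¹.val.transpose := by
            rw [Matrix.mul_smul, Matrix.smul_mul]
        _ = (A⁻¹.val * A.val) * Matrix.J l R * (A.val.transpose * A⁻¹.val.transpose) := by
            rw [← hc]; simp only [Matrix.mul_assoc]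
        _ = Matrix.J l R := by rw [h1, h2, Matrix.one_mul, Matrix.mul_one]
    calc A⁻¹.val * Matrix.J l R * A⁻¹.val.transpose
        = ((c⁻¹ : Rˣ) : R) • ((c : R) • (A⁻¹.val * Matrix.J l R * A⁻¹.val.transpose)) := by
          rw [smul_smul, Units.inv_mul, one_smul]
      _ = ((c⁻¹ : Rˣ) : R) • Matrix.J l R := by rw [h3]

/-- The rational prime `q` splits (completely) in the number field `K`: every prime of the ring of
integers of `K` above `q` has ramification index `1` and inertia degree `1`. -/
def SplitsIn (q : ℕ) (K : Type*) [Field K] [NumberField K] : Prop :=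
  ∀ Q ∈ (Ideal.span {(q : ℤ)}).primesOver (NumberField.RingOfIntegers K),
    Q.ramificationIdx ℤ = 1 ∧ Q.inertiaDeg ℤ = 1

/-! Choice of p. If |F| = ℓ^r, an element of prime order p ≠ ℓ in GSp_n(F) ⊆ GL_n(F) forces p ∣
ℓ^(rk) - 1 for some 1 ≤ k ≤ n, by the formula for |GL_n(F)|. When t·n! divides the order of ℓ modulo
p, it follows that tk ∣ rk, so t ∣ r and F contains the field with ℓ^t elements. A prime p for which
this order is a multiple of a prescribed m comes from a cyclotomic value Φ_j(ℓ) with m ∣ j: any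
prime factor not dividing j will do. One exists because, for 4 ∣ j, a prime dividing j occurs at
most once in the value, while j can be chosen so that the value exceeds j. Including n[K:ℚ] and N as
factors of m gives n[K:ℚ] ∣ p - 1 and p > N.

Choice of q. A pole argument and Möbius inversion replace Chebotarev's theorem. Let M = K(ζ_p), let
H_d be the group of σ in Gal(M/ℚ) that are trivial on K and whose cyclotomic character has d-th
power 1, and let E_d be its fixed field. For d ∣ n the group H_d is normal of order d. For almost
all q, the number N_d(q) of ideals of norm q in E_d is [E_d:ℚ] if Frob_q ∈ H_d and 0 otherwise, so a
Möbius combination ∑ c_d N_d(q) over d ∣ n is the indicator of the wanted q. If only finitely many q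
were suitable, the combination would vanish for almost all q. But ∑_q N_d(q) q^(-s) = log(1/(s-1)) +
O(1) as s → 1+, for every d, because the Dedekind zeta function has a simple pole at 1. This would
force ∑ c_d = 0, whereas the sum is φ(n)/[M:ℚ]. -/

/-! ### Prime factors of cyclotomic values. -/

open Polynomial in
/-- The exponent of a prime divisor `p` of `n` in the value `Φₙ(a)` is at most one when `4 ∣ n`. -/
theorem not_sq_dvd_cyclotomic_eval {n p a : ℕ} (ha : 2 ≤ a) (hn0 : n ≠ 0) (hn : 4 ∣ n)
    (hp : p.Prime) (hpn : p ∣ n) : ¬ (p : ℤ) ^ 2 ∣ (cyclotomic n ℤ).eval (a : ℤ) := by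
  obtain ⟨k, rfl⟩ := hpn
  intro h
  have hk0 : k ≠ 0 := by rintro rfl; simp at hn0
  have hprop : k ∈ (p * k).properDivisors := by
    rw [Nat.mem_properDivisors]
    exact ⟨Dvd.intro_left p rfl, by nlinarith [hp.two_le, Nat.pos_of_ne_zero hk0]⟩
  have h1 := eval_dvd (x := (a : ℤ)) (X_pow_sub_one_mul_cyclotomic_dvd_X_pow_sub_one_of_dvd ℤ hprop)
  simp only [eval_mul, eval_sub, eval_pow, eval_X, eval_one] at h1
  set x : ℤ := (a : ℤ) ^ k with hx
  have hx1 : x - 1 ≠ 0 := by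
    have : 1 < (a : ℤ) ^ k := one_lt_pow₀ (by exact_mod_cast ha) hk0
    rw [hx]; omega
  -- Φ_{pk} divides (X^(pk) - 1)/(X^k - 1), so it suffices that p² does not divide 1 + x + ... +
  -- x^(p-1).
  have h2 : (cyclotomic (p * k) ℤ).eval (a : ℤ) ∣ ∑ i ∈ Finset.range p, x ^ i := by
    have : (a : ℤ) ^ (p * k) - 1 = (x - 1) * ∑ i ∈ Finset.range p, x ^ i := by
      rw [mul_comm (x - 1), geom_sum_mul, hx, ← pow_mul, mul_comm p]
    rw [this] at h1
    exact (mul_dvd_mul_iff_left hx1).mp h1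
  have h3 := h.trans h2
  rcases hp.eq_two_or_odd' with rfl | hodd
  -- Since 4 ∣ 2 * k, x is a square, and 1 + x is 1 or 2 modulo 4.
  · obtain ⟨j, hj⟩ : 2 ∣ k := by omega
    have hsq : x = ((a : ℤ) ^ j) ^ 2 := by rw [hx, hj, ← pow_mul, mul_comm]
    simp only [Finset.sum_range_succ, Finset.sum_range_zero, pow_zero, pow_one, zero_add] at h3
    rw [hsq] at h3
    rcases Int.emod_two_eq_zero_or_one ((a : ℤ) ^ j) with e | e
    · obtain ⟨c, hc⟩ : ∃ c, (a : ℤ) ^ j = 2 * c := ⟨_, (Int.mul_ediv_cancel' (Int.dvd_of_emod_eq_zero e)).symm⟩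
      rw [hc] at h3
      have : (1 + (2 * c) ^ 2) = 1 + 4 * c ^ 2 := by ring
      push_cast at h3
      omega
    · obtain ⟨c, hc⟩ : ∃ c, (a : ℤ) ^ j = 2 * c + 1 := ⟨(a : ℤ) ^ j / 2, by omega⟩
      rw [hc] at h3
      have : (1 + (2 * c + 1) ^ 2) = 2 + 4 * (c ^ 2 + c) := by ring
      push_cast at h3
      omega
  -- For odd p, Fermat's little theorem gives p ∣ x - 1, and then the sum is congruent to p modulo
  -- p².
  · have := Fact.mk hp
    have hmod : (p : ℤ) ∣ x - 1 := by
      have h4 : (p : ℤ) ∣ x ^ p - 1 := by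
        rw [← geom_sum_mul]
        exact ((dvd_pow_self _ two_ne_zero).trans h3).mul_right _
      rw [← ZMod.intCast_zmod_eq_zero_iff_dvd] at h4 ⊢
      push_cast at h4 ⊢
      rwa [ZMod.pow_card] at h4
    obtain ⟨b, hb⟩ := hmod
    have h5 := odd_sq_dvd_geom_sum₂_sub (R := ℤ) (a := 1) b hodd
    simp only [one_pow, mul_one] at h5
    rw [show 1 + (p : ℤ) * b = x by linarith] at h5
    have h6 : (p : ℤ) ^ 2 ∣ p := (dvd_sub_right h3).mp h5
    have h7 : p ^ 2 ∣ p := by exact_mod_cast h6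
    have := Nat.le_of_dvd hp.pos h7
    nlinarith [hp.two_le]

-- Doubling an even index substitutes X² for X. Hence the index can grow by powers of 2 while the
-- value grows doubly exponentially.
open Polynomial in
theorem cyclotomic_mul_two_pow_eval (m k : ℕ) (hm : 2 ∣ m) (x : ℤ) :
    (cyclotomic (m * 2 ^ k) ℤ).eval x = (cyclotomic m ℤ).eval (x ^ 2 ^ k) := by
  induction k generalizing x with
  | zero => simp
  | succ k ih =>
    rw [pow_succ, ← mul_assoc, ← cyclotomic_expand_eq_cyclotomic Nat.prime_two
      (hm.mul_right _), expand_eval, ih, ← pow_mul, mul_comm 2]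

open Polynomial in
/-- For `a ≥ 2` and `m ≥ 1` there is a prime `p` modulo which the order of `a` is finite and
divisible by `m`. -/
theorem exists_prime_dvd_orderOf (a m : ℕ) (ha : 2 ≤ a) (hm : m ≠ 0) :
    ∃ p : ℕ, p.Prime ∧ ¬ p ∣ a ∧ m ∣ orderOf (a : ZMod p) := by
  -- The 4 serves `not_sq_dvd_cyclotomic_eval`; the power of 2 makes the value Φ_{4m}(a^(2^(4m))),
  -- which exceeds M.
  set M := 4 * m * 2 ^ (4 * m) with hM
  have hM0 : M ≠ 0 := by positivity
  have h4M : 4 ∣ M := ⟨m * 2 ^ (4 * m), by rw [hM]; ring⟩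
  set V := ((cyclotomic M ℤ).eval (a : ℤ)).natAbs with hV
  have hlarge : M < V := by
    have h1 := sub_one_pow_totient_lt_natAbs_cyclotomic_eval (n := 4 * m) (q := a ^ 2 ^ (4 * m))
      (by omega) (ne_of_gt (one_lt_pow₀ (by omega) (by positivity)))
    rw [Nat.cast_pow, ← cyclotomic_mul_two_pow_eval (4 * m) (4 * m) ⟨2 * m, by ring⟩] at h1
    refine lt_of_le_of_lt ?_ h1
    have h2 : 2 ^ 2 ^ (4 * m) ≤ a ^ 2 ^ (4 * m) := Nat.pow_le_pow_left ha _
    have h3 : 2 * (4 * m) ≤ 2 ^ (4 * m) := by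
      have := Nat.lt_two_pow_self (n := 4 * m - 1)
      have e : 4 * m = (4 * m - 1) + 1 := by omega
      rw [e, pow_succ]; omega
    have h4 : 2 ^ (2 * (4 * m)) ≤ 2 ^ 2 ^ (4 * m) := Nat.pow_le_pow_right (by norm_num) h3
    have h5 : 4 * m + 1 ≤ 2 ^ (4 * m) := Nat.lt_two_pow_self
    have h6 : M + 1 ≤ 2 ^ (2 * (4 * m)) := by
      rw [two_mul, pow_add, hM]
      have : 0 < 2 ^ (4 * m) := by positivity
      nlinarith
    calc M ≤ a ^ 2 ^ (4 * m) - 1 := by omega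
      _ ≤ (a ^ 2 ^ (4 * m) - 1) ^ (4 * m).totient :=
        Nat.le_self_pow (Nat.totient_pos.mpr (by omega)).ne' _
  obtain ⟨p, hp, hpV, hpM⟩ : ∃ p : ℕ, p.Prime ∧ p ∣ V ∧ ¬ p ∣ M := by
    by_contra! hcon
    have hsq : Squarefree V := by
      rw [Nat.squarefree_iff_prime_squarefree]
      intro p hp hpp
      refine not_sq_dvd_cyclotomic_eval ha hM0 h4M hp (hcon p hp (dvd_of_mul_left_dvd hpp)) ?_
      rw [← Int.natCast_dvd_natCast, hV, Int.dvd_natAbs] at hpp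
      simpa [sq] using hpp
    -- If all primes of the squarefree V divide M, then so does V, against M < V.
    have hle : V ∣ M := by
      rw [← Nat.prod_primeFactors_of_squarefree hsq]
      refine (Finset.prod_dvd_prod_of_subset _ _ _ fun p hp => ?_).trans (Nat.prod_primeFactors_dvd M)
      rw [Nat.mem_primeFactors] at hp ⊢
      exact ⟨hp.1, hcon p hp.1 hp.2.1, hM0⟩
    exact absurd (Nat.le_of_dvd (Nat.pos_of_ne_zero hM0) hle) (not_le.mpr hlarge)
  have := Fact.mk hp
  have : NeZero (M : ZMod p) := ⟨by rwa [Ne, ZMod.natCast_eq_zero_iff]⟩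
  have hroot : (cyclotomic M (ZMod p)).IsRoot (a : ZMod p) := by
    rw [IsRoot.def, ← map_cyclotomic_int, eval_natCast_map, eq_intCast,
      ZMod.intCast_zmod_eq_zero_iff_dvd, ← Int.dvd_natAbs]
    exact_mod_cast hpV
  have hprim := isRoot_cyclotomic_iff.mp hroot
  refine ⟨p, hp, ?_, ?_⟩
  · intro h
    rw [(ZMod.natCast_eq_zero_iff a p).mpr h] at hprim
    exact hprim.ne_zero hM0 rfl
  · rw [← hprim.eq_orderOf]
    exact ⟨4 * 2 ^ (4 * m), by rw [hM]; ring⟩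

/-! ### Subfields forced by elements of order p. -/

theorem nonempty_ringHom_galoisField {ℓ t r : ℕ} [Fact ℓ.Prime] (ht : t ≠ 0) {F : Type*} [Field F]
    [Finite F] [CharP F ℓ] (hF : Nat.card F = ℓ ^ r) (htr : t ∣ r) :
    Nonempty (GaloisField ℓ t →+* F) := by
  let := ZMod.algebra F ℓ
  have hr : Module.finrank (ZMod ℓ) F = r := by
    have h := Module.natCard_eq_pow_finrank (K := ZMod ℓ) (V := F)
    rw [hF, Nat.card_zmod] at h
    exact (Nat.pow_right_injective (Fact.out : ℓ.Prime).two_le h).symm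
  have h : Module.finrank (ZMod ℓ) (GaloisField ℓ t) ∣ Module.finrank (ZMod ℓ) F := by
    rwa [GaloisField.finrank ℓ ht, hr]
  exact (FiniteField.nonempty_algHom_of_finrank_dvd h).map fun f => f.toRingHom

/-- With Q = |F| and d the size of the matrices, |GL_d(F)| is the product of the Q^i (Q^(d-i) - 1)
for i < d, and p does not divide Q. -/
theorem exists_dvd_card_pow_sub_one_of_dvd_card_GL {F : Type*} [Field F] [Finite F] {ι : Type*}
    [Fintype ι] [DecidableEq ι] {p : ℕ} (hp : p.Prime) (hpF : ¬ p ∣ Nat.card F)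
    (h : p ∣ Nat.card (GL ι F)) :
    ∃ k, 0 < k ∧ k ≤ Fintype.card ι ∧ p ∣ Nat.card F ^ k - 1 := by
  have := Fintype.ofFinite F
  rw [Nat.card_congr (Units.mapEquiv (Matrix.reindexAlgEquiv F F
    (Fintype.equivFin ι)).toRingEquiv.toMulEquiv).toEquiv, Matrix.card_GL_field,
    hp.prime.dvd_finsetProd_iff] at h
  obtain ⟨i, -, hi⟩ := h
  rw [← Nat.card_eq_fintype_card (α := F)] at hi
  refine ⟨Fintype.card ι - i, by omega, by omega, ?_⟩
  have e : Nat.card F ^ Fintype.card ι - Nat.card F ^ (i : ℕ)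
      = Nat.card F ^ (i : ℕ) * (Nat.card F ^ (Fintype.card ι - i) - 1) := by
    rw [Nat.mul_sub, ← pow_add, mul_one, Nat.add_sub_cancel' i.2.le]
  rw [e, hp.dvd_mul] at hi
  exact hi.resolve_left fun h => hpF (hp.dvd_of_dvd_pow h)

/-- A finite field `F` of characteristic `ℓ` whose group `GSp` has an element of prime order `p`
contains the field with `ℓ ^ t` elements, once the order of `ℓ` modulo `p` is divisible by
`t * (2m)!`. -/
theorem nonempty_ringHom_galoisField_of_orderOf_GSp {ι : Type*} [Fintype ι] [DecidableEq ι]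
    {ℓ t p : ℕ} [Fact ℓ.Prime] (ht : t ≠ 0) (hp : p.Prime) (hpℓ : ¬ p ∣ ℓ)
    (hord : t * (Fintype.card (ι ⊕ ι)).factorial ∣ orderOf (ℓ : ZMod p))
    {F : Type*} [Field F] [Finite F] [CharP F ℓ] (g : GSp ι F) (hg : orderOf g = p) :
    Nonempty (GaloisField ℓ t →+* F) := by
  have := Fintype.ofFinite F
  obtain ⟨r, -, hr⟩ := FiniteField.card F ℓ
  rw [← Nat.card_eq_fintype_card] at hr
  have hdvd : p ∣ Nat.card (GL (ι ⊕ ι) F) := by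
    rw [← hg, ← Subgroup.orderOf_coe]
    exact orderOf_dvd_natCard _
  obtain ⟨k, hk0, hk, hpk⟩ := exists_dvd_card_pow_sub_one_of_dvd_card_GL hp
    (by rw [hr]; exact fun h => hpℓ (hp.dvd_of_dvd_pow h)) hdvd
  refine nonempty_ringHom_galoisField ht hr ?_
  have h1 : orderOf (ℓ : ZMod p) ∣ r * k := by
    rw [orderOf_dvd_iff_pow_eq_one, pow_mul]
    have : ((Nat.card F ^ k - 1 : ℕ) : ZMod p) = 0 := (ZMod.natCast_eq_zero_iff _ _).mpr hpk
    rw [Nat.cast_sub (Nat.one_le_pow _ _ Nat.card_pos), hr, sub_eq_zero] at this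
    simpa using this
  -- As k is at most the matrix size, it divides the factorial, and can be cancelled at the end.
  have h2 : t * k ∣ r * k :=
    ((mul_dvd_mul_left t (Nat.dvd_factorial hk0 hk)).trans hord).trans h1
  exact Nat.dvd_of_mul_dvd_mul_right hk0 h2

/-! ### Counting ideals of given norm. -/

namespace NumberField

open _root_.Ideal UniqueFactorizationMonoid

variable (L : Type*) [Field L] [NumberField L]

/-- The number of ideals of norm `n` in the ring of integers of `L`. -/
noncomputable def idealCount (n : ℕ) : ℕ := Nat.card {I : Ideal (𝓞 L) // absNorm I = n}

instance finite_absNorm_eq (n : ℕ) : Finite {I : Ideal (𝓞 L) // absNorm I = n} :=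
  finite_setOfPred_absNorm_eq n

theorem idealCount_one : idealCount L 1 = 1 := by
  simp [idealCount, absNorm_eq_one_iff]

variable {L}

theorem isPrimePow_absNorm_of_prime {P : Ideal (𝓞 L)} (hP : Prime P) :
    IsPrimePow (absNorm P) := by
  have := (isPrime_of_prime hP).isMaximal hP.ne_zero
  obtain ⟨p, n, hn, -, hp, h⟩ := exists_prime_and_absNorm_eq_pow P
  exact (isPrimePow_nat_iff _).mpr ⟨p, n, hp, hn, h.symm⟩

/-- The norm of a prime ideal is a prime power, so each prime factor of I can be assigned to one of
the coprime factors m, n. -/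
theorem exists_mul_eq_of_absNorm_eq_mul_of_coprime {I : Ideal (𝓞 L)} (hI : I ≠ 0) :
    ∀ {m n : ℕ}, m.Coprime n → absNorm I = m * n →
      ∃ J₁ J₂ : Ideal (𝓞 L), absNorm J₁ = m ∧ absNorm J₂ = n ∧ J₁ * J₂ = I := by
  induction I using induction_on_prime with
  | h₁ => exact absurd rfl hI
  | h₂ I hu =>
    intro m n _ h
    rw [Ideal.isUnit_iff.mp hu, absNorm_top] at h
    obtain ⟨rfl, rfl⟩ := mul_eq_one.mp h.symm
    exact ⟨1, 1, by simp, by simp, by rw [one_mul, Ideal.isUnit_iff.mp hu, one_eq_top]⟩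
  | h₃ I P hI0 hP ih =>
    intro m n hmn h
    rw [_root_.map_mul] at h
    have hpp := isPrimePow_absNorm_of_prime hP
    have hP0 : 0 < absNorm P := hpp.pos
    rcases (hmn.isPrimePow_dvd_mul hpp).mp (h ▸ dvd_mul_right _ _) with ⟨c, hc⟩ | ⟨c, hc⟩
    · obtain ⟨J₁, J₂, h1, h2, h3⟩ := ih hI0 (m := c) (n := n)
        (hmn.coprime_dvd_left ⟨_, hc.trans (mul_comm _ _)⟩)
        (Nat.eq_of_mul_eq_mul_left hP0 (by rw [h, hc, mul_assoc]))
      exact ⟨P * J₁, J₂, by rw [_root_.map_mul, h1, hc], h2, by rw [mul_assoc, h3]⟩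
    · obtain ⟨J₁, J₂, h1, h2, h3⟩ := ih hI0 (m := m) (n := c)
        (hmn.coprime_dvd_right ⟨_, hc.trans (mul_comm _ _)⟩)
        (Nat.eq_of_mul_eq_mul_left hP0 (by rw [h, hc]; ring))
      exact ⟨J₁, P * J₂, h1, by rw [_root_.map_mul, h2, hc], by rw [← h3]; ring⟩

theorem isCoprime_of_coprime_absNorm {I J : Ideal (𝓞 L)}
    (h : (absNorm I).Coprime (absNorm J)) : IsCoprime I J := by
  rw [Ideal.isCoprime_iff_sup_eq, ← absNorm_eq_one_iff]
  exact Nat.eq_one_of_dvd_coprimes h (absNorm_dvd_absNorm_of_le le_sup_left)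
    (absNorm_dvd_absNorm_of_le le_sup_right)

variable (L) in
theorem idealCount_mul_of_coprime {m n : ℕ} (hm : m ≠ 0) (hn : n ≠ 0) (hmn : m.Coprime n) :
    idealCount L (m * n) = idealCount L m * idealCount L n := by
  rw [idealCount, idealCount, idealCount, ← Nat.card_prod]
  symm
  refine Nat.card_congr (Equiv.ofBijective
    (fun x => ⟨x.1.1 * x.2.1, by rw [_root_.map_mul, x.1.2, x.2.2]⟩) ⟨?_, ?_⟩)
  · rintro ⟨⟨I, hI⟩, ⟨J, hJ⟩⟩ ⟨⟨I', hI'⟩, ⟨J', hJ'⟩⟩ h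
    simp only [Subtype.mk.injEq] at h
    have c1 : IsCoprime I J' := isCoprime_of_coprime_absNorm (by rwa [hI, hJ'])
    have c2 : IsCoprime I' J := isCoprime_of_coprime_absNorm (by rwa [hI', hJ])
    have e : I = I' := dvd_antisymm
      (c1.dvd_of_dvd_mul_right (h ▸ dvd_mul_right _ _))
      (c2.dvd_of_dvd_mul_right (h ▸ dvd_mul_right _ _))
    subst e
    have hI0 : I ≠ 0 := by
      rintro rfl
      exact hm (by rw [← hI]; simp)
    have e2 : J = J' := mul_left_cancel₀ hI0 h
    subst e2
    rfl
  · rintro ⟨I, hI⟩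
    have hI0 : I ≠ 0 := by
      rintro rfl
      exact mul_ne_zero hm hn (by rw [← hI]; simp)
    obtain ⟨J₁, J₂, h1, h2, h3⟩ := exists_mul_eq_of_absNorm_eq_mul_of_coprime hI0 hmn hI
    exact ⟨⟨⟨J₁, h1⟩, ⟨J₂, h2⟩⟩, by simp [h3]⟩

instance finite_primesOver_span (q : ℕ) [Fact q.Prime] :
    Finite ((span {(q : ℤ)}).primesOver (𝓞 L)) := by
  have : (span {(q : ℤ)}).IsPrime :=
    (span_singleton_prime (by exact_mod_cast (Fact.out : q.Prime).ne_zero)).mpr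
      (Nat.prime_iff_prime_int.mp Fact.out)
  exact Algebra.QuasiFinite.finite_primesOver _

variable (L) in
theorem card_primesOver_span_le (q : ℕ) [Fact q.Prime] :
    Nat.card ((span {(q : ℤ)}).primesOver (𝓞 L)) ≤ Module.finrank ℚ L := by
  have : (span {(q : ℤ)}).IsPrime :=
    (span_singleton_prime (by exact_mod_cast (Fact.out : q.Prime).ne_zero)).mpr
      (Nat.prime_iff_prime_int.mp Fact.out)
  have := Fintype.ofFinite ((span {(q : ℤ)}).primesOver (𝓞 L))
  rw [← RingOfIntegers.rank, ← sum_ramification_inertia_eq_finrank (span {(q : ℤ)}) (𝓞 L),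
    Nat.card_eq_fintype_card, ← Finset.card_univ, Finset.card_eq_sum_ones]
  refine Finset.sum_le_sum fun P _ => ?_
  have := P.2.1
  exact Nat.mul_pos (P.1.ramificationIdx_pos ℤ) (P.1.inertiaDeg_pos ℤ)

theorem mem_primesOver_span_of_absNorm {q e : ℕ} (hq : q.Prime) {I P : Ideal (𝓞 L)}
    (hI : absNorm I = q ^ e) (hP : P.IsPrime) (hPI : I ≤ P) :
    P ∈ (span {(q : ℤ)}).primesOver (𝓞 L) := by
  refine ⟨hP, (liesOver_span_iff hP.ne_top (Nat.prime_iff_prime_int.mp hq)).mpr ?_⟩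
  have h := hPI (absNorm_mem I)
  rw [hI, Nat.cast_pow] at h
  simpa using hP.mem_of_pow_mem _ h

-- An ideal of norm q^e is determined by its exponents, each at most e, at the primes above q, of
-- which there are at most [L:ℚ].
open Classical in
variable (L) in
theorem idealCount_prime_pow_le {q : ℕ} (hq : q.Prime) (e : ℕ) :
    idealCount L (q ^ e) ≤ (e + 1) ^ Module.finrank ℚ L := by
  have := Fact.mk hq
  have hne {I : Ideal (𝓞 L)} (hI : absNorm I = q ^ e) : I ≠ 0 := by
    rintro rfl
    exact pow_ne_zero e hq.ne_zero (by rw [← hI]; simp)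
  have hcount {I P : Ideal (𝓞 L)} (hI : absNorm I = q ^ e) :
      (normalizedFactors I).count P < e + 1 := by
    by_cases hP : P ∈ normalizedFactors I
    · have hprime := prime_of_normalized_factor P hP
      have h1 : P ^ (normalizedFactors I).count P ∣ I := by
        conv_rhs => rw [← Ideal.prod_normalizedFactors_eq_self (hne hI)]
        rw [← Multiset.prod_replicate]
        exact Multiset.prod_dvd_prod_of_le (Multiset.le_count_iff_replicate_le.mp le_rfl)
      have h2 := absNorm_dvd_absNorm_of_le (le_of_dvd h1)
      rw [hI, _root_.map_pow] at h2
      have h3 : q ∣ absNorm P := by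
        have h4 := absNorm_dvd_absNorm_of_le (le_of_dvd (dvd_of_mem_normalizedFactors hP))
        rw [hI, Nat.dvd_prime_pow hq] at h4
        obtain ⟨k, -, hk⟩ := h4
        rw [hk]
        refine dvd_pow_self _ ?_
        rintro rfl
        exact hprime.not_isUnit (Ideal.isUnit_iff.mpr (absNorm_eq_one_iff.mp (by simpa using hk)))
      exact Nat.lt_succ_of_le ((Nat.pow_dvd_pow_iff_le_right hq.one_lt).mp
        ((pow_dvd_pow_of_dvd h3 _).trans h2))
    · rw [Multiset.count_eq_zero_of_notMem hP]
      omega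
  have hinj : Function.Injective (fun (I : {I : Ideal (𝓞 L) // absNorm I = q ^ e})
      (P : (span {(q : ℤ)}).primesOver (𝓞 L)) =>
        (⟨(normalizedFactors I.1).count P.1, hcount I.2⟩ : Fin (e + 1))) := by
    rintro ⟨I, hI⟩ ⟨J, hJ⟩ h
    have hmem {I P : Ideal (𝓞 L)} (hI : absNorm I = q ^ e) (hP : P ∈ normalizedFactors I) :
        P ∈ (span {(q : ℤ)}).primesOver (𝓞 L) :=
      mem_primesOver_span_of_absNorm hq hI (isPrime_of_prime (prime_of_normalized_factor P hP))
        (le_of_dvd (dvd_of_mem_normalizedFactors hP))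
    have hfac : normalizedFactors I = normalizedFactors J := by
      ext P
      by_cases hP : P ∈ (span {(q : ℤ)}).primesOver (𝓞 L)
      · simpa using congr_fun h ⟨P, hP⟩
      · rw [Multiset.count_eq_zero_of_notMem fun h => hP (hmem hI h),
          Multiset.count_eq_zero_of_notMem fun h => hP (hmem hJ h)]
    rw [Subtype.mk.injEq, ← Ideal.prod_normalizedFactors_eq_self (hne hI), hfac,
      Ideal.prod_normalizedFactors_eq_self (hne hJ)]
  have := Fintype.ofFinite ((span {(q : ℤ)}).primesOver (𝓞 L))
  refine (Nat.card_le_card_of_injective _ hinj).trans ?_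
  rw [Nat.card_eq_fintype_card, Fintype.card_fun, Fintype.card_fin, ← Nat.card_eq_fintype_card]
  exact Nat.pow_le_pow_right (by omega) (card_primesOver_span_le L q)

end NumberField

/-! ### The Dedekind zeta function and its Euler product near 1. -/

namespace NumberField

open Filter Topology

variable (L : Type*) [Field L] [NumberField L]

/-- The real Dirichlet series of the Dedekind zeta function. -/
noncomputable def realZeta (s : ℝ) : ℝ := ∑' n : ℕ, (idealCount L n : ℝ) * (n : ℝ) ^ (-s)

variable {L}

theorem term_idealCount {s : ℝ} (hs : s ≠ 0) (n : ℕ) :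
    LSeries.term (fun n => (idealCount L n : ℂ)) s n
      = (((idealCount L n : ℝ) * (n : ℝ) ^ (-s) : ℝ) : ℂ) := by
  rcases eq_or_ne n 0 with rfl | hn
  · simp [Real.zero_rpow (neg_ne_zero.mpr hs)]
  · rw [LSeries.term_of_ne_zero hn, Complex.ofReal_mul,
      Complex.ofReal_cpow (Nat.cast_nonneg n), Complex.ofReal_neg, Complex.cpow_neg, div_eq_mul_inv]
    simp

theorem tendsto_sum_idealCount_div :
    Tendsto (fun n : ℕ => (∑ k ∈ Finset.Icc 1 n, (idealCount L k : ℝ)) / n) atTop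
      (𝓝 (dedekindZeta_residue L)) := by
  refine ((Ideal.tendsto_norm_le_div_atTop₀ L).comp tendsto_natCast_atTop_atTop).congr fun n ↦ ?_
  simp only [Function.comp_apply, Nat.cast_le, ← Nat.cast_sum, idealCount]
  congr
  -- The 1 added to both sides accounts for the zero ideal, the only one of norm 0.
  rw [← add_left_inj 1, ← _root_.Ideal.card_norm_le_eq_card_norm_le_add_one,
    show Finset.Icc 1 n = Finset.Ioc 0 n from Finset.Icc_succ_left_eq_Ioc _ _,
    show 1 = Nat.card {I : _root_.Ideal (𝓞 L) // _root_.Ideal.absNorm I = 0} by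
      simp [_root_.Ideal.absNorm_eq_zero_iff],
    Finset.sum_Ioc_add_eq_sum_Icc (n.zero_le),
    ← Finset.card_preimage_eq_sum_card_image_eq
      (fun k _ ↦ _root_.Ideal.finite_setOfPred_absNorm_eq k)]
  simp [Set.coe_eq_subtype]

theorem summable_idealCount {s : ℝ} (hs : 1 < s) :
    Summable fun n : ℕ => (idealCount L n : ℝ) * (n : ℝ) ^ (-s) := by
  have hO : (fun n : ℕ => ∑ k ∈ Finset.Icc 1 n, (idealCount L k : ℝ)) =O[atTop]
      fun n : ℕ => (n : ℝ) ^ (1 : ℝ) := by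
    simp_rw [Real.rpow_one]
    refine Asymptotics.isBigO_of_div_tendsto_nhds ?_ _ tendsto_sum_idealCount_div
    filter_upwards [eventually_ne_atTop 0] with n hn h
    exact absurd h (Nat.cast_ne_zero.mpr hn)
  have h := LSeriesSummable_of_sum_norm_bigO_and_nonneg hO (fun _ => Nat.cast_nonneg _)
    zero_le_one (s := s) (by simpa using hs)
  rw [LSeriesSummable] at h
  rw [← Complex.summable_ofReal]
  refine h.congr fun n => ?_
  rw [← term_idealCount (by linarith)]
  simp

theorem ofReal_realZeta {s : ℝ} (hs : s ≠ 0) : ((realZeta L s : ℝ) : ℂ) = dedekindZeta L s := by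
  rw [realZeta, Complex.ofReal_tsum, dedekindZeta, LSeries]
  exact tsum_congr fun n => (term_idealCount hs n).symm

theorem one_le_realZeta {s : ℝ} (hs : 1 < s) : 1 ≤ realZeta L s := by
  have h := (summable_idealCount (L := L) hs).le_tsum 1 (fun n _ => by positivity)
  rw [realZeta]
  simpa [idealCount_one] using h

variable (L) in
theorem tendsto_sub_one_mul_realZeta :
    Tendsto (fun s : ℝ => (s - 1) * realZeta L s) (𝓝[>] 1) (𝓝 (dedekindZeta_residue L)) := by
  rw [← Filter.tendsto_ofReal_iff]
  refine (tendsto_sub_one_mul_dedekindZeta_nhdsGT L).congr' ?_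
  filter_upwards [self_mem_nhdsWithin] with s hs
  have hs' : s ≠ 0 := by have : (1 : ℝ) < s := hs; linarith
  rw [← ofReal_realZeta hs']
  push_cast
  ring

variable (L) in
theorem tendsto_log_realZeta_sub :
    Tendsto (fun s : ℝ => Real.log (realZeta L s) - Real.log (1 / (s - 1))) (𝓝[>] 1)
      (𝓝 (Real.log (dedekindZeta_residue L))) := by
  refine ((Real.continuousAt_log (dedekindZeta_residue_ne_zero L)).tendsto.comp
    (tendsto_sub_one_mul_realZeta L)).congr' ?_
  filter_upwards [self_mem_nhdsWithin] with s hs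
  have h1 : (1 : ℝ) < s := hs
  have := one_le_realZeta (L := L) h1
  rw [Function.comp_apply, Real.log_mul (by linarith) (by linarith), one_div, Real.log_inv]
  ring

theorem hasProd_realZeta {s : ℝ} (hs : 1 < s) :
    HasProd (fun q : Nat.Primes => ∑' e : ℕ, (idealCount L (q ^ e) : ℝ) * ((q ^ e : ℕ) : ℝ) ^ (-s))
      (realZeta L s) := by
  have h0 : ((0 : ℕ) : ℝ) ^ (-s) = 0 := by
    rw [Nat.cast_zero, Real.zero_rpow (by linarith)]
  refine EulerProduct.eulerProduct_hasProd
    (f := fun n : ℕ => (idealCount L n : ℝ) * (n : ℝ) ^ (-s)) (by simp [idealCount_one])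
    (fun {m n} hmn => ?_) ?_ (by rw [h0, mul_zero])
  · rcases eq_or_ne m 0 with rfl | hm
    · rw [zero_mul, h0]; simp
    rcases eq_or_ne n 0 with rfl | hn
    · rw [mul_zero, h0]; simp
    rw [idealCount_mul_of_coprime L hm hn hmn, Nat.cast_mul, Nat.cast_mul,
      Real.mul_rpow (Nat.cast_nonneg _) (Nat.cast_nonneg _)]
    ring
  · exact (summable_idealCount hs).norm

variable (L) in
/-- A uniform bound for the terms of order at least two in the Euler factors. -/
noncomputable def eulerTailBound : ℝ :=
  ∑' e : ℕ, ((e : ℝ) + 3) ^ Module.finrank ℚ L * (1 / 2 : ℝ) ^ e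

variable (L) in
theorem summable_eulerTailBound :
    Summable fun e : ℕ => ((e : ℝ) + 3) ^ Module.finrank ℚ L * (1 / 2 : ℝ) ^ e := by
  have h := (summable_pow_mul_geometric_of_norm_lt_one (Module.finrank ℚ L)
    (r := (1 / 2 : ℝ)) (by norm_num)).comp_injective (add_left_injective 3)
  refine (h.mul_left 8).congr fun e => ?_
  simp only [Function.comp_apply, pow_add]
  push_cast
  ring

/-- The terms with e ≥ 2 are at most a constant times q^(-2s), uniformly in q and s, because the
coefficients grow polynomially in e and q^(-s) ≤ 1/2. -/
theorem euler_factor_bounds {s : ℝ} (hs : 1 < s) (q : Nat.Primes) :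
    1 + idealCount L q * (q : ℝ) ^ (-s) ≤
      ∑' e : ℕ, (idealCount L (q ^ e) : ℝ) * ((q ^ e : ℕ) : ℝ) ^ (-s) ∧
    ∑' e : ℕ, (idealCount L (q ^ e) : ℝ) * ((q ^ e : ℕ) : ℝ) ^ (-s) ≤
      1 + idealCount L q * (q : ℝ) ^ (-s) + eulerTailBound L * ((q : ℝ) ^ (-s)) ^ 2 := by
  set x : ℝ := (q : ℝ) ^ (-s) with hx
  have hq2 : (2 : ℝ) ≤ q := by exact_mod_cast q.2.two_le
  have hx0 : 0 ≤ x := by positivity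
  have hx2 : x ≤ 1 / 2 := by
    calc x ≤ (q : ℝ) ^ (-1 : ℝ) := Real.rpow_le_rpow_of_exponent_le (by linarith) (by linarith)
      _ = 1 / (q : ℝ) := by rw [Real.rpow_neg_one, one_div]
      _ ≤ 1 / 2 := by gcongr
  have hterm (e : ℕ) : (idealCount L (q ^ e) : ℝ) * ((q ^ e : ℕ) : ℝ) ^ (-s)
      = idealCount L (q ^ e) * x ^ e := by
    rw [hx, Nat.cast_pow, ← Real.rpow_natCast, ← Real.rpow_natCast, ← Real.rpow_mul (by positivity),
      ← Real.rpow_mul (by positivity), mul_comm (e : ℝ)]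
  simp_rw [hterm]
  have hsum : Summable fun e : ℕ => (idealCount L (q ^ e) : ℝ) * x ^ e := by
    refine ((summable_idealCount (L := L) hs).comp_injective
      (Nat.pow_right_injective q.2.two_le)).congr fun e => ?_
    exact hterm e
  have htail : ∀ e : ℕ, (idealCount L (q ^ (e + 2)) : ℝ) * x ^ (e + 2)
      ≤ ((e : ℝ) + 3) ^ Module.finrank ℚ L * (1 / 2 : ℝ) ^ e * x ^ 2 := by
    intro e
    have h1 : (idealCount L (q ^ (e + 2)) : ℝ) ≤ ((e : ℝ) + 3) ^ Module.finrank ℚ L := by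
      have := idealCount_prime_pow_le L q.2 (e + 2)
      have h : ((e : ℝ) + 3) = ((e + 2 + 1 : ℕ) : ℝ) := by push_cast; ring
      rw [h]
      exact_mod_cast this
    rw [pow_add x, ← mul_assoc]
    gcongr
  have hsplit := hsum.sum_add_tsum_nat_add 2
  simp only [Finset.sum_range_succ, Finset.sum_range_zero, pow_zero, pow_one, idealCount_one,
    Nat.cast_one, mul_one, zero_add] at hsplit
  rw [← hsplit]
  constructor
  · exact le_add_of_nonneg_right (tsum_nonneg fun e => by positivity)
  · gcongr
    rw [eulerTailBound, ← tsum_mul_right]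
    exact Summable.tsum_le_tsum htail ((summable_nat_add_iff 2).mpr hsum)
      ((summable_eulerTailBound L).mul_right _)

theorem summable_primes_idealCount {s : ℝ} (hs : 1 < s) :
    Summable fun q : Nat.Primes => (idealCount L q : ℝ) * (q : ℝ) ^ (-s) :=
  (summable_idealCount (L := L) hs).comp_injective Nat.Primes.coe_nat_injective

theorem abs_log_euler_factor_sub_le {s : ℝ} (hs : 1 < s) (q : Nat.Primes) :
    |Real.log (∑' e : ℕ, (idealCount L (q ^ e) : ℝ) * ((q ^ e : ℕ) : ℝ) ^ (-s))
        - idealCount L q * (q : ℝ) ^ (-s)| ≤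
      (eulerTailBound L + (2 ^ Module.finrank ℚ L) ^ 2) * (q : ℝ) ^ (-2 : ℝ) := by
  obtain ⟨hlo, hhi⟩ := euler_factor_bounds (L := L) hs q
  set F := ∑' e : ℕ, (idealCount L (q ^ e) : ℝ) * ((q ^ e : ℕ) : ℝ) ^ (-s)
  set x : ℝ := (q : ℝ) ^ (-s) with hx
  have hq1 : (1 : ℝ) ≤ q := by exact_mod_cast q.2.one_lt.le
  have hx0 : 0 ≤ x := by positivity
  have hxx : x ^ 2 ≤ (q : ℝ) ^ (-2 : ℝ) := by
    rw [hx, ← Real.rpow_natCast, ← Real.rpow_mul (by positivity)]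
    exact Real.rpow_le_rpow_of_exponent_le hq1 (by push_cast; linarith)
  have hC : 0 ≤ eulerTailBound L := tsum_nonneg fun e => by positivity
  set a : ℝ := (idealCount L q : ℝ) with ha
  have ha0 : 0 ≤ a := Nat.cast_nonneg _
  have ha2 : a ≤ 2 ^ Module.finrank ℚ L := by
    have := idealCount_prime_pow_le L q.2 1
    rw [pow_one] at this
    rw [ha]; exact_mod_cast this
  have hax : 0 ≤ a * x := mul_nonneg ha0 hx0
  have hF : 0 < F := by linarith
  have hup : Real.log F - a * x ≤ eulerTailBound L * x ^ 2 := by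
    have := Real.log_le_sub_one_of_pos hF
    linarith
  have hdown : -((2 ^ Module.finrank ℚ L) ^ 2 * x ^ 2) ≤ Real.log F - a * x := by
    have h1 := Real.log_le_log (by linarith) hlo
    have h2 := Real.one_sub_inv_le_log_of_pos (x := 1 + a * x) (by linarith)
    -- With y = a * x ≥ 0 this is y(1 - y) ≤ y/(1 + y).
    have h3 : a * x - (a * x) ^ 2 ≤ 1 - (1 + a * x)⁻¹ := by
      rw [le_sub_comm, inv_le_iff_one_le_mul₀ (by linarith)]
      nlinarith [pow_nonneg hax 3]
    have h4 : (a * x) ^ 2 ≤ (2 ^ Module.finrank ℚ L) ^ 2 * x ^ 2 := by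
      rw [mul_pow]; gcongr
    linarith
  have h5 : 0 ≤ ((2 : ℝ) ^ Module.finrank ℚ L) ^ 2 := by positivity
  rw [abs_le]
  constructor <;> nlinarith

variable (L) in
/-- The sum over primes that governs the logarithm of the Dedekind zeta function near `1`. -/
theorem exists_abs_tsum_primes_sub_log_le :
    ∃ C : ℝ, ∀ᶠ s : ℝ in 𝓝[>] 1,
      |∑' q : Nat.Primes, (idealCount L q : ℝ) * (q : ℝ) ^ (-s) - Real.log (1 / (s - 1))| ≤ C := by
  set B : ℝ := eulerTailBound L + (2 ^ Module.finrank ℚ L) ^ 2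
  have hsum2 : Summable fun q : Nat.Primes => B * (q : ℝ) ^ (-2 : ℝ) :=
    ((Nat.Primes.summable_rpow (r := -2)).mpr (by norm_num)).mul_left B
  refine ⟨∑' q : Nat.Primes, B * (q : ℝ) ^ (-2 : ℝ) + (|Real.log (dedekindZeta_residue L)| + 1), ?_⟩
  have hev := (tendsto_log_realZeta_sub L).abs.eventually
    (gt_mem_nhds (lt_add_one |Real.log (dedekindZeta_residue L)|))
  filter_upwards [hev, self_mem_nhdsWithin] with s h1 hs
  have hs1 : (1 : ℝ) < s := hs
  set F : Nat.Primes → ℝ :=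
    fun q => ∑' e : ℕ, (idealCount L (q ^ e) : ℝ) * ((q ^ e : ℕ) : ℝ) ^ (-s) with hF
  have hFpos (q : Nat.Primes) : 0 < F q := by
    have := (euler_factor_bounds (L := L) hs1 q).1
    have h2 : (0 : ℝ) ≤ idealCount L q * (q : ℝ) ^ (-s) := by positivity
    linarith
  have hlog : HasSum (fun q => Real.log (F q)) (Real.log (realZeta L s)) := by
    have hpos : 0 < realZeta L s := lt_of_lt_of_le one_pos (one_le_realZeta hs1)
    refine ((Real.continuousAt_log hpos.ne').tendsto.comp (hasProd_realZeta (L := L) hs1)).congr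
      fun t => ?_
    rw [Function.comp_apply, Real.log_prod fun q _ => (hFpos q).ne']
  have hdiff := hlog.sub (summable_primes_idealCount (L := L) hs1).hasSum
  have hbd : |Real.log (realZeta L s) - ∑' q : Nat.Primes, (idealCount L q : ℝ) * (q : ℝ) ^ (-s)|
      ≤ ∑' q : Nat.Primes, B * (q : ℝ) ^ (-2 : ℝ) := by
    rw [← hdiff.tsum_eq, ← Real.norm_eq_abs]
    exact tsum_of_norm_bounded hsum2.hasSum fun q => abs_log_euler_factor_sub_le hs1 q
  rw [abs_le] at hbd
  have h1' := abs_le.mp h1.le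
  rw [abs_le]
  constructor <;> linarith [hbd.1, hbd.2, h1'.1, h1'.2]

/-- Linear relations between the numbers of prime ideals of norm `q` in finitely many number
fields, valid for almost all primes `q`, have coefficients that add up to zero. -/
theorem sum_eq_zero_of_forall_sum_mul_idealCount_eq_zero {ι : Type*} (t : Finset ι)
    (E : ι → Type*) [∀ i, Field (E i)] [∀ i, NumberField (E i)] (c : ι → ℝ) {B : Set ℕ}
    (hB : B.Finite)
    (h : ∀ q : ℕ, q.Prime → q ∉ B → ∑ i ∈ t, c i * idealCount (E i) q = 0) :
    ∑ i ∈ t, c i = 0 := by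
  choose C hC using fun i => exists_abs_tsum_primes_sub_log_le (E i)
  have hBP : ((fun q : Nat.Primes => (q : ℕ)) ⁻¹' B).Finite :=
    hB.preimage Nat.Primes.coe_nat_injective.injOn
  set S : Finset Nat.Primes := hBP.toFinset with hS
  set w : Nat.Primes → ℝ := fun q => ∑ i ∈ t, c i * idealCount (E i) q with hw
  have hbound : ∀ᶠ s : ℝ in 𝓝[>] 1,
      |(∑ i ∈ t, c i) * Real.log (1 / (s - 1))| ≤ ∑ i ∈ t, |c i| * C i + ∑ q ∈ S, |w q| := by
    filter_upwards [(Filter.eventually_all_finset t).mpr fun i _ => hC i, self_mem_nhdsWithin]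
      with s hs hs1
    have hs1 : (1 : ℝ) < s := hs1
    -- By the relation `h`, only the finitely many exceptional primes contribute, and their
    -- contribution stays bounded.
    have e1 : ∑ i ∈ t, c i * ∑' q : Nat.Primes, (idealCount (E i) q : ℝ) * (q : ℝ) ^ (-s)
        = ∑ q ∈ S, w q * (q : ℝ) ^ (-s) := by
      simp_rw [← tsum_mul_left]
      rw [← Summable.tsum_finsetSum
        fun i _ => (summable_primes_idealCount (L := E i) hs1).mul_left (c i)]
      rw [← tsum_eq_sum (L := SummationFilter.unconditional _) (s := S)
        (f := fun q : Nat.Primes => w q * (q : ℝ) ^ (-s))]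
      · refine tsum_congr fun q => ?_
        rw [hw, Finset.sum_mul]
        exact Finset.sum_congr rfl fun i _ => by ring
      · intro q hq
        rw [hw]
        simp only
        rw [h q q.2 (by simpa [hS] using hq), zero_mul]
    have e2 : |∑ q ∈ S, w q * (q : ℝ) ^ (-s)| ≤ ∑ q ∈ S, |w q| := by
      refine (Finset.abs_sum_le_sum_abs _ _).trans (Finset.sum_le_sum fun q _ => ?_)
      rw [abs_mul, abs_of_nonneg (a := (q : ℝ) ^ (-s)) (by positivity)]
      refine mul_le_of_le_one_right (abs_nonneg _) ?_
      exact Real.rpow_le_one_of_one_le_of_nonpos (by exact_mod_cast q.2.one_lt.le) (by linarith)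
    have e3 : |∑ i ∈ t, c i * (∑' q : Nat.Primes, (idealCount (E i) q : ℝ) * (q : ℝ) ^ (-s)
        - Real.log (1 / (s - 1)))| ≤ ∑ i ∈ t, |c i| * C i := by
      refine (Finset.abs_sum_le_sum_abs _ _).trans (Finset.sum_le_sum fun i hi => ?_)
      rw [abs_mul]
      exact mul_le_mul_of_nonneg_left (hs i hi) (abs_nonneg _)
    have e4 : (∑ i ∈ t, c i) * Real.log (1 / (s - 1)) = ∑ q ∈ S, w q * (q : ℝ) ^ (-s)
        - ∑ i ∈ t, c i * (∑' q : Nat.Primes, (idealCount (E i) q : ℝ) * (q : ℝ) ^ (-s)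
        - Real.log (1 / (s - 1))) := by
      rw [← e1, Finset.sum_mul, ← Finset.sum_sub_distrib]
      exact Finset.sum_congr rfl fun i _ => by ring
    rw [e4]
    exact (abs_sub _ _).trans (by linarith)
  by_contra hne
  have hlog : Tendsto (fun s : ℝ => Real.log (1 / (s - 1))) (𝓝[>] 1) atTop := by
    refine Real.tendsto_log_atTop.comp ?_
    simp_rw [one_div]
    refine tendsto_inv_nhdsGT_zero.comp ?_
    refine tendsto_nhdsWithin_iff.mpr ⟨?_, ?_⟩
    · have : Tendsto (fun s : ℝ => s - 1) (𝓝 1) (𝓝 (1 - 1)) := tendsto_id.sub_const 1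
      rw [sub_self] at this
      exact this.mono_left nhdsWithin_le_nhds
    · filter_upwards [self_mem_nhdsWithin] with s hs
      exact sub_pos.mpr (Set.mem_Ioi.mp hs)
  have habs : Tendsto (fun s : ℝ => |(∑ i ∈ t, c i) * Real.log (1 / (s - 1))|) (𝓝[>] 1) atTop := by
    simp_rw [abs_mul]
    exact (tendsto_abs_atTop_atTop.comp hlog).const_mul_atTop (abs_pos.mpr hne)
  obtain ⟨s, hs1, hs2⟩ := (hbound.and (habs.eventually_gt_atTop _)).exists
  exact absurd hs1 (not_le.mpr hs2)

end NumberField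

/-! ### Frobenius elements and splitting of primes. -/

namespace NumberField

open _root_.Ideal

variable {L : Type*} [Field L] {q : ℕ}

theorem isPrime_span_natCast (hq : q.Prime) : (span {(q : ℤ)}).IsPrime :=
  (span_singleton_prime (by exact_mod_cast hq.ne_zero)).mpr (Nat.prime_iff_prime_int.mp hq)

theorem card_quotient_under_of_mem_primesOver {Q : Ideal (𝓞 L)}
    (hQ : Q ∈ (span {(q : ℤ)}).primesOver (𝓞 L)) : Nat.card (ℤ ⧸ Q.under ℤ) = q := by
  rw [← hQ.2.over]
  exact (absNorm_apply _).symm.trans (by simp)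

theorem isMaximal_of_mem_primesOver (hq : q.Prime) {Q : Ideal (𝓞 L)}
    (hQ : Q ∈ (span {(q : ℤ)}).primesOver (𝓞 L)) : Q.IsMaximal := by
  have := hQ.1
  have := hQ.2
  have := isPrime_span_natCast hq
  have : (span {(q : ℤ)}).IsMaximal := this.isMaximal (by simpa using hq.ne_zero)
  exact IsMaximal.of_liesOver_isMaximal Q (span {(q : ℤ)})

variable {M : Type*} [Field M] [Algebra L M]

theorem under_mem_primesOver {Q : Ideal (𝓞 M)} (hQ : Q ∈ (span {(q : ℤ)}).primesOver (𝓞 M)) :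
    Q.under (𝓞 L) ∈ (span {(q : ℤ)}).primesOver (𝓞 L) := by
  have := hQ.1
  have := hQ.2
  exact ⟨inferInstance, ⟨by rw [under_under]; exact hQ.2.over⟩⟩

variable [NumberField L]

theorem pow_inertiaDeg_of_mem_primesOver {Q : Ideal (𝓞 L)}
    (hQ : Q ∈ (span {(q : ℤ)}).primesOver (𝓞 L)) : q ^ Q.inertiaDeg ℤ = Nat.card (𝓞 L ⧸ Q) := by
  have := hQ.1
  have := hQ.2
  exact pow_inertiaDeg q Q

/-- The identity is a Frobenius element at a prime exactly when the inertia degree is one. -/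
theorem isArithFrobAt_one_iff (hq : q.Prime) {Q : Ideal (𝓞 L)}
    (hQ : Q ∈ (span {(q : ℤ)}).primesOver (𝓞 L)) :
    IsArithFrobAt ℤ (1 : Gal(L/ℚ)) Q ↔ Q.inertiaDeg ℤ = 1 := by
  have := isMaximal_of_mem_primesOver hq hQ
  let := Quotient.field Q
  have hcard := pow_inertiaDeg_of_mem_primesOver hQ
  have hfin : Finite (𝓞 L ⧸ Q) := Nat.finite_of_card_ne_zero
    (by rw [← hcard]; exact pow_ne_zero _ hq.ne_zero)
  have := Fintype.ofFinite (𝓞 L ⧸ Q)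
  have hiff : IsArithFrobAt ℤ (1 : Gal(L/ℚ)) Q ↔ ∀ x : 𝓞 L ⧸ Q, x ^ q = x := by
    rw [IsArithFrobAt, AlgHom.IsArithFrobAt, card_quotient_under_of_mem_primesOver hQ]
    refine ⟨fun h x => ?_, fun h x => ?_⟩
    · obtain ⟨x, rfl⟩ := Ideal.Quotient.mk_surjective x
      have := h x
      rw [← Ideal.Quotient.eq, map_pow] at this
      rw [← this]
      simp
    · rw [← Ideal.Quotient.eq, map_pow, h]
      simp
  rw [hiff]
  constructor
  · intro h
    -- Every element of the residue field is a root of X^q - X.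
    have h1 : Fintype.card (𝓞 L ⧸ Q) ≤ q := by
      have hne : (Polynomial.X ^ q - Polynomial.X : Polynomial (𝓞 L ⧸ Q)) ≠ 0 :=
        FiniteField.X_pow_card_sub_X_ne_zero _ hq.one_lt
      have h2 := Polynomial.card_le_degree_of_subset_roots (p := (Polynomial.X ^ q - Polynomial.X :
        Polynomial (𝓞 L ⧸ Q))) (Z := Finset.univ) (fun x _ => by
          simp only [Polynomial.mem_roots hne, Polynomial.IsRoot.def, Polynomial.eval_sub,
            Polynomial.eval_pow, Polynomial.eval_X, h x, sub_self])
      rwa [FiniteField.X_pow_card_sub_X_natDegree_eq _ hq.one_lt, Finset.card_univ] at h2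
    rw [← Nat.card_eq_fintype_card, ← hcard] at h1
    have h3 : Q.inertiaDeg ℤ ≤ 1 :=
      (Nat.pow_le_pow_iff_right hq.one_lt).mp (by simpa using h1)
    have := Q.inertiaDeg_pos ℤ
    omega
  · intro h x
    rw [h, pow_one, Nat.card_eq_fintype_card] at hcard
    conv_lhs => rw [hcard]
    exact FiniteField.pow_card x

theorem isArithFrobAt_unique [IsGalois ℚ L] {Q : Ideal (𝓞 L)} [Q.IsPrime] [Algebra.IsUnramifiedAt ℤ Q]
    {σ τ : Gal(L/ℚ)} (hσ : IsArithFrobAt ℤ σ Q) (hτ : IsArithFrobAt ℤ τ Q) : σ = τ := by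
  have h := hσ.eq_of_isUnramifiedAt hτ Q.primeCompl_le_nonZeroDivisors
  have : FaithfulSMul Gal(L/ℚ) (𝓞 L) :=
    (inferInstance : IsGaloisGroup Gal(L/ℚ) ℤ (𝓞 L)).faithful
  refine FaithfulSMul.eq_of_smul_eq_smul (α := 𝓞 L) fun x => ?_
  exact DFunLike.congr_fun h x

/-- If `q` is unramified in the Galois number field `L`, the number of ideals of norm `q` is the
degree of `L` or zero, according to whether the Frobenius elements at `q` are trivial or not. -/
theorem idealCount_prime_eq [IsGalois ℚ L] (hq : q.Prime)
    (hur : Algebra.IsUnramifiedIn (𝓞 L) (span {(q : ℤ)})) {Q : Ideal (𝓞 L)}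
    (hQ : Q ∈ (span {(q : ℤ)}).primesOver (𝓞 L)) {σ : Gal(L/ℚ)} (hσ : IsArithFrobAt ℤ σ Q)
    [Decidable (σ = 1)] :
    idealCount L q = if σ = 1 then Module.finrank ℚ L else 0 := by
  have hp := isPrime_span_natCast hq
  have hQ1 := hQ.1
  have hQ2 := hQ.2
  have hnorm {P : Ideal (𝓞 L)} (hP : P ∈ (span {(q : ℤ)}).primesOver (𝓞 L)) :
      absNorm P = q ↔ P.inertiaDeg ℤ = 1 := by
    rw [absNorm_apply]
    refine Eq.congr_left (pow_inertiaDeg_of_mem_primesOver hP).symm |>.trans ?_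
    exact Nat.pow_eq_self_iff hq.one_lt
  have hmem {P : Ideal (𝓞 L)} (hP : absNorm P = q) : P ∈ (span {(q : ℤ)}).primesOver (𝓞 L) :=
    mem_primesOver_span_of_absNorm hq (e := 1) (by simpa using hP)
      (isPrime_of_irreducible_absNorm (by rw [hP]; exact hq)) le_rfl
  have hdeg {P : Ideal (𝓞 L)} (hP : P ∈ (span {(q : ℤ)}).primesOver (𝓞 L)) :
      P.inertiaDeg ℤ = Q.inertiaDeg ℤ := by
    have := hP.1
    have := hP.2
    exact inertiaDeg_eq_of_isGaloisGroup (span {(q : ℤ)}) P Q Gal(L/ℚ)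
  have : Algebra.IsUnramifiedAt ℤ Q := hur Q hQ1 hQ2
  have hone : σ = 1 ↔ Q.inertiaDeg ℤ = 1 := by
    rw [← isArithFrobAt_one_iff hq hQ]
    exact ⟨fun h => h ▸ hσ, fun h => isArithFrobAt_unique hσ h⟩
  split_ifs with h
  -- A trivial Frobenius gives e = f = 1 at all primes above q: each has norm q, and there are [L:ℚ]
  -- of them.
  · have hset : {I : Ideal (𝓞 L) | absNorm I = q} = (span {(q : ℤ)}).primesOver (𝓞 L) := by
      ext I
      exact ⟨fun hI => hmem hI, fun hI => (hnorm hI).mpr ((hdeg hI).trans (hone.mp h))⟩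
    have h1 := ncard_primesOver_mul_ramificationIdxIn_mul_inertiaDegIn (span {(q : ℤ)}) (𝓞 L)
      Gal(L/ℚ)
    rw [inertiaDegIn_eq_inertiaDeg _ Q Gal(L/ℚ), ramificationIdxIn_eq_ramificationIdx _ Q Gal(L/ℚ),
      hone.mp h, hur.ramificationIdx_eq_one hQ2, mul_one, mul_one,
      IsGalois.card_aut_eq_finrank] at h1
    rw [← h1, ← hset]
    rfl
  · rw [idealCount, Nat.card_eq_zero]
    left
    refine ⟨fun ⟨P, hP⟩ => h (hone.mpr ?_)⟩
    rw [← hdeg (hmem hP)]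
    exact (hnorm (hmem hP)).mp hP

theorem splitsIn_of_isArithFrobAt_one [IsGalois ℚ L] (hq : q.Prime)
    (hur : Algebra.IsUnramifiedIn (𝓞 L) (span {(q : ℤ)})) {Q : Ideal (𝓞 L)}
    (hQ : Q ∈ (span {(q : ℤ)}).primesOver (𝓞 L)) (h : IsArithFrobAt ℤ (1 : Gal(L/ℚ)) Q) :
    SplitsIn q L := by
  intro P hP
  have := isPrime_span_natCast hq
  have := hQ.1
  have := hQ.2
  have := hP.1
  have := hP.2
  refine ⟨hur.ramificationIdx_eq_one hP.2, ?_⟩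
  rw [inertiaDeg_eq_of_isGaloisGroup (span {(q : ℤ)}) P Q Gal(L/ℚ)]
  exact (isArithFrobAt_one_iff hq hQ).mp h

variable [NumberField M]

/-- A Frobenius element restricts to a Frobenius element on a Galois subfield. -/
theorem isArithFrobAt_restrictNormalHom [IsGalois ℚ L] {Q : Ideal (𝓞 M)} {σ : Gal(M/ℚ)}
    (hσ : IsArithFrobAt ℤ σ Q) :
    IsArithFrobAt ℤ (AlgEquiv.restrictNormalHom L σ) (Q.under (𝓞 L)) := by
  intro x
  have h := hσ (algebraMap (𝓞 L) (𝓞 M) x)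
  rw [mem_comap, map_sub, map_pow, under_under]
  convert h using 2
  refine RingOfIntegers.ext ?_
  exact AlgEquiv.restrictNormal_commutes σ L x

/-- Ramification of a prime P of L would persist at a prime of M above P. -/
theorem isUnramifiedIn_of_algebra
    (hur : Algebra.IsUnramifiedIn (𝓞 M) (span {(q : ℤ)})) :
    Algebra.IsUnramifiedIn (𝓞 L) (span {(q : ℤ)}) := by
  intro P hP hPq
  obtain ⟨⟨Q, hQ, hQP⟩⟩ := (inferInstance : Nonempty (P.primesOver (𝓞 M)))
  have : Q.LiesOver (span {(q : ℤ)}) := .trans Q P _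
  have : Algebra.IsUnramifiedAt ℤ Q := hur Q hQ this
  exact Algebra.IsUnramifiedAt.of_liesOver ℤ P Q

end NumberField

/-! ### Torsion in cyclic groups and Möbius sums. -/

/-- In a finite group `G` with a homomorphism `χ` to a cyclic group that is injective on the kernel
of `f`, the elements `σ` of `ker f` with `χ σ ^ d = 1` are `d` in number for `d ∣ |ker f|`. -/
theorem card_ker_prod_powMonoidHom_comp {G A C : Type*} [Group G] [Finite G] [Group A] [CommGroup C]
    [IsCyclic C] (f : G →* A) (χ : G →* C) (hinj : ∀ σ, f σ = 1 → χ σ = 1 → σ = 1) {d : ℕ}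
    (hd : d ∣ Nat.card f.ker) :
    Nat.card (f.prod ((powMonoidHom d).comp χ)).ker = d := by
  have hχ : Function.Injective (χ.comp f.ker.subtype) := by
    rw [injective_iff_map_eq_one]
    exact fun σ hσ => Subtype.ext (hinj σ.1 σ.2 hσ)
  let S := (χ.comp f.ker.subtype).range
  have e : f.ker ≃* S := MonoidHom.ofInjective hχ
  have : Finite S := Finite.of_equiv _ e.toEquiv
  -- S is a cyclic copy of `f.ker`, so its d-torsion has gcd(|S|, d) = d elements.
  have h := IsCyclic.card_powMonoidHom_ker (G := S) d
  rw [← Nat.card_congr e.toEquiv, Nat.gcd_eq_right hd] at h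
  refine (Nat.card_congr (Equiv.ofBijective
    (fun σ => ⟨⟨χ σ.1, ⟨⟨σ.1, (Prod.ext_iff.mp σ.2).1⟩, rfl⟩⟩,
      Subtype.ext (Prod.ext_iff.mp σ.2).2⟩) ⟨?_, ?_⟩)).trans h
  · intro σ τ h
    have h' : χ σ.1 = χ τ.1 := congrArg (fun x => x.1.1) h
    have h1 : f σ.1 = 1 := (Prod.ext_iff.mp σ.2).1
    have h2 : f τ.1 = 1 := (Prod.ext_iff.mp τ.2).1
    refine Subtype.ext (inv_mul_eq_one.mp (hinj _ ?_ ?_))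
    · simp [h1, h2]
    · simp [h']
  · rintro ⟨⟨_, ⟨σ, hσ⟩, rfl⟩, hx⟩
    refine ⟨⟨σ, Prod.ext hσ ?_⟩, rfl⟩
    exact congrArg Subtype.val hx

-- Möbius inversion turns the conditions o ∣ d, for d ∣ n, into the exact condition n = o.
open ArithmeticFunction in
theorem sum_moebius_mul_ite_dvd {n : ℕ} (hn : 0 < n) (o : ℕ) :
    ∑ d ∈ n.divisors, ((moebius (n / d) : ℤ) : ℝ) * (if o ∣ d then 1 else 0) =
      if n = o then 1 else 0 := by
  have h := (sum_eq_iff_sum_mul_moebius_eq (R := ℝ)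
    (f := fun m => if m = o then 1 else 0) (g := fun m => if o ∣ m then 1 else 0)).mp
    (fun m hm => by simp [Finset.sum_ite_eq', Nat.mem_divisors, hm.ne']) n hn
  rw [← h]
  exact (Nat.sum_divisorsAntidiagonal'
    (fun a b => ((moebius a : ℤ) : ℝ) * (if o ∣ b then 1 else 0))).symm

open ArithmeticFunction in
theorem sum_moebius_mul_self {n : ℕ} (hn : 0 < n) :
    ∑ d ∈ n.divisors, ((moebius (n / d) : ℤ) : ℝ) * d = n.totient := by
  have h := (sum_eq_iff_sum_mul_moebius_eq (R := ℝ)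
    (f := fun m => (m.totient : ℝ)) (g := fun m => (m : ℝ))).mp
    (fun m hm => by exact_mod_cast Nat.sum_totient m) n hn
  rw [← h]
  exact (Nat.sum_divisorsAntidiagonal' (fun a b => ((moebius a : ℤ) : ℝ) * (b : ℝ))).symm

/-! ### Galois theory of K(ζ_p). -/

namespace NumberField

open _root_.Ideal

/-- If K is the splitting field of f over ℚ, then K(ζ_p) is that of f·(X^p - 1). -/
theorem isGalois_cyclotomicField (K : Type*) [Field K] [NumberField K] [IsGalois ℚ K] (p : ℕ)
    [NeZero p] : IsGalois ℚ (CyclotomicField p K) := by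
  obtain ⟨f, hf, hsplit⟩ := IsGalois.is_separable_splitting_field ℚ K
  have h2 : Polynomial.IsSplittingField K (CyclotomicField p K)
      ((Polynomial.X ^ p - 1 : Polynomial ℚ).map (algebraMap ℚ K)) := by
    simpa using IsCyclotomicExtension.isSplittingField_X_pow_sub_one p K (CyclotomicField p K)
  have h3 := Polynomial.IsSplittingField.mul (K := K) (CyclotomicField p K) f (Polynomial.X ^ p - 1)
    hf.ne_zero (Polynomial.X_pow_sub_C_ne_zero (NeZero.pos p) 1)
  have := Normal.of_isSplittingField (F := ℚ) (E := CyclotomicField p K)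
    (f * (Polynomial.X ^ p - 1))
  exact {}

/-- For `σ` a Frobenius element at a prime above `q`, the cyclotomic character takes the value `q`. -/
theorem autToPow_eq_of_isArithFrobAt {M : Type*} [Field M] [NumberField M] {p q : ℕ} [Fact p.Prime]
    (hq : q.Prime) (hpq : p ≠ q) {ζ : M} (hζ : IsPrimitiveRoot ζ p) {Q : Ideal (𝓞 M)}
    (hQ : Q ∈ (span {(q : ℤ)}).primesOver (𝓞 M)) {σ : Gal(M/ℚ)} (hσ : IsArithFrobAt ℤ σ Q) :
    ((hζ.autToPow ℚ σ : (ZMod p)ˣ) : ZMod p) = q := by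
  have hp : p.Prime := Fact.out
  have := hQ.1
  have hpQ : ((p : ℕ) : 𝓞 M) ∉ Q := by
    intro h
    have h1 : (p : ℤ) ∈ Q.under ℤ := by simpa [mem_comap] using h
    rw [← hQ.2.over, mem_span_singleton, Int.natCast_dvd_natCast] at h1
    exact hpq ((Nat.prime_dvd_prime_iff_eq hq hp).mp h1).symm
  have hint := hζ.toInteger_isPrimitiveRoot
  have h1 := hσ.apply_of_pow_eq_one hint.pow_eq_one hpQ
  rw [card_quotient_under_of_mem_primesOver hQ] at h1
  have h2 : σ ζ = ζ ^ q := congrArg (algebraMap (𝓞 M) M) h1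
  rw [← hζ.autToPow_spec ℚ σ, pow_eq_pow_mod q hζ.pow_eq_one] at h2
  have h3 := hζ.pow_inj (ZMod.val_lt _) (Nat.mod_lt _ hp.pos) h2
  rw [← ZMod.natCast_zmod_val ((hζ.autToPow ℚ σ : (ZMod p)ˣ) : ZMod p), h3, ZMod.natCast_mod]

theorem restrictNormalHom_eq_one_iff {K M : Type*} [Field K] [CharZero K] [Field M] [CharZero M]
    [Algebra K M] [Normal ℚ K] {σ : Gal(M/ℚ)} :
    AlgEquiv.restrictNormalHom K σ = 1 ↔ ∀ x : K, σ (algebraMap K M x) = algebraMap K M x := by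
  refine ⟨fun h x => ?_, fun h => AlgEquiv.ext fun x => (algebraMap K M).injective ?_⟩
  · rw [← AlgEquiv.restrictNormal_commutes σ K x]
    exact congrArg (algebraMap K M) (DFunLike.congr_fun h x)
  · exact (AlgEquiv.restrictNormal_commutes σ K x).trans (h x)

theorem restrictNormalHom_fixedField_eq_one_iff {M : Type*} [Field M] [NumberField M]
    (H : Subgroup Gal(M/ℚ)) [Normal ℚ (IntermediateField.fixedField H)] {σ : Gal(M/ℚ)} :
    AlgEquiv.restrictNormalHom (IntermediateField.fixedField H) σ = 1 ↔ σ ∈ H := by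
  conv_rhs => rw [← IntermediateField.fixingSubgroup_fixedField H,
    IntermediateField.mem_fixingSubgroup_iff]
  rw [restrictNormalHom_eq_one_iff]
  exact ⟨fun h x hx => h ⟨x, hx⟩, fun h x => h x x.2⟩

/-- An automorphism of `K(ζ)` that is trivial on `K` and fixes `ζ` is the identity. -/
theorem eq_one_of_autToPow_eq_one {K M : Type*} [Field K] [CharZero K] [Field M] [CharZero M]
    [Algebra K M] [Normal ℚ K] {p : ℕ} [NeZero p] [IsCyclotomicExtension {p} K M] {ζ : M}
    (hζ : IsPrimitiveRoot ζ p) {σ : Gal(M/ℚ)} (hσ : AlgEquiv.restrictNormalHom K σ = 1)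
    (hχ : hζ.autToPow ℚ σ = 1) : σ = 1 := by
  have hK := restrictNormalHom_eq_one_iff.mp hσ
  have hζσ : σ ζ = ζ := by
    rcases eq_or_ne p 1 with rfl | hp
    · rw [IsPrimitiveRoot.one_right_iff.mp hζ, map_one]
    · have := Fact.mk (show 1 < p by have := NeZero.pos p; omega)
      rw [← hζ.autToPow_spec ℚ σ, hχ, Units.val_one, ZMod.val_one, pow_one]
  let φ : M →ₐ[K] M := { (σ : M →+* M) with commutes' := hK }
  have h := AlgHom.ext_of_adjoin_eq_top (φ₁ := φ) (φ₂ := AlgHom.id K M)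
    (IsCyclotomicExtension.adjoin_primitive_root_eq_top hζ)
    (fun x hx => by rw [Set.mem_singleton_iff.mp hx]; exact hζσ)
  exact AlgEquiv.ext fun x => DFunLike.congr_fun h x

/-- The degree `[K(ζ) : K]` is divisible by `n` once `n * [K : ℚ]` divides `p - 1`. -/
theorem dvd_card_ker_restrictNormalHom {K M : Type*} [Field K] [NumberField K] [IsGalois ℚ K]
    [Field M] [NumberField M] [IsGalois ℚ M] [Algebra K M] {p n : ℕ} (hp : p.Prime) {ζ : M}
    (hζ : IsPrimitiveRoot ζ p) (h : n * Module.finrank ℚ K ∣ p - 1) :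
    n ∣ Nat.card (AlgEquiv.restrictNormalHom (F := ℚ) (K₁ := M) K).ker := by
  -- M contains ζ, whose minimal polynomial Φ_p has degree p - 1.
  have h1 : p - 1 ∣ Module.finrank ℚ M := by
    have := minpoly.degree_dvd (K := ℚ) (hζ.isIntegral hp.pos).tower_top
    rwa [← Polynomial.cyclotomic_eq_minpoly_rat hζ hp.pos, Polynomial.natDegree_cyclotomic,
      Nat.totient_prime hp] at this
  have h2 := Subgroup.card_mul_index (AlgEquiv.restrictNormalHom (F := ℚ) (K₁ := M) K).ker
  rw [Subgroup.index_ker, MonoidHom.range_eq_top.mpr (AlgEquiv.restrictNormalHom_surjective M),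
    Subgroup.card_top, IsGalois.card_aut_eq_finrank, IsGalois.card_aut_eq_finrank] at h2
  rw [← h2] at h1
  exact Nat.dvd_of_mul_dvd_mul_right Module.finrank_pos (h.trans h1)

end NumberField

/-! ### Existence of q. -/

namespace NumberField

open _root_.Ideal

/-- Let `K` be a Galois number field and `p` a prime with `n * [K : ℚ] ∣ p - 1`. Outside any finite
set there is a prime `q` that splits in `K` and has order `n` modulo `p`. -/
theorem exists_prime_splitsIn_orderOf (K : Type*) [Field K] [NumberField K] [IsGalois ℚ K]
    {p n : ℕ} (hp : p.Prime) (hn : 0 < n) (h : n * Module.finrank ℚ K ∣ p - 1) {B : Set ℕ}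
    (hB : B.Finite) :
    ∃ q : ℕ, q.Prime ∧ q ∉ B ∧ SplitsIn q K ∧
      ∃ u : (ZMod p)ˣ, (u : ZMod p) = (q : ZMod p) ∧ orderOf u = n := by
  classical
  have := Fact.mk hp
  let M := CyclotomicField p K
  have : IsGalois ℚ M := isGalois_cyclotomicField K p
  have hζ := IsCyclotomicExtension.zeta_spec p K M
  set ζ : M := IsCyclotomicExtension.zeta p K M
  let f : Gal(M/ℚ) →* Gal(K/ℚ) := AlgEquiv.restrictNormalHom K
  let χ : Gal(M/ℚ) →* (ZMod p)ˣ := hζ.autToPow ℚ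
  let H (d : ℕ) : Subgroup Gal(M/ℚ) := (f.prod ((powMonoidHom d).comp χ)).ker
  have hmemH (d : ℕ) (σ : Gal(M/ℚ)) : σ ∈ H d ↔ f σ = 1 ∧ χ σ ^ d = 1 := by
    rw [MonoidHom.mem_ker, Prod.ext_iff]
    rfl
  have hcard : ∀ d ∈ n.divisors, Nat.card (H d) = d := fun d hd =>
    card_ker_prod_powMonoidHom_comp f χ (fun σ h1 h2 => eq_one_of_autToPow_eq_one hζ h1 h2)
      ((Nat.dvd_of_mem_divisors hd).trans (dvd_card_ker_restrictNormalHom hp hζ h))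
  let E (d : ℕ) : IntermediateField ℚ M := IntermediateField.fixedField (H d)
  have hE (d : ℕ) : IsGalois ℚ (E d) := IsGalois.of_fixedField_normal_subgroup (H d)
  have hdeg : ∀ d ∈ n.divisors, Module.finrank ℚ (E d) * d = Module.finrank ℚ M := by
    intro d hd
    rw [← Module.finrank_mul_finrank ℚ (E d) M, IntermediateField.finrank_fixedField_eq_card,
      hcard d hd]
  have hD : (0 : ℝ) < Module.finrank ℚ M := by exact_mod_cast Module.finrank_pos
  -- The weight d/[M:ℚ] = 1/[E_d:ℚ] normalizes the ideal count to the indicator of σ ∈ H_d.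
  let c (d : ℕ) : ℝ :=
    ((ArithmeticFunction.moebius (n / d) : ℤ) : ℝ) * (d / Module.finrank ℚ M)
  have hc : ∑ d ∈ n.divisors, c d ≠ 0 := by
    have : ∑ d ∈ n.divisors, c d = n.totient / Module.finrank ℚ M := by
      rw [← sum_moebius_mul_self hn, Finset.sum_div]
      exact Finset.sum_congr rfl fun d _ => by simp only [c]; ring
    rw [this]
    exact (div_pos (by exact_mod_cast Nat.totient_pos.mpr hn) hD).ne'
  by_contra! hcon
  -- Also excluded are p, to which the character formula does not apply, and the primes that may
  -- ramify in M.
  refine hc (sum_eq_zero_of_forall_sum_mul_idealCount_eq_zero n.divisors (fun d => E d) c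
    (B := B ∪ ({p} ∪ {q | q ∣ (discr M).natAbs})) (hB.union ((Set.finite_singleton p).union ?_)) ?_)
  · refine (Set.finite_Iic (discr M).natAbs).subset fun q hq => ?_
    exact Nat.le_of_dvd (Int.natAbs_pos.mpr (discr_ne_zero M)) hq
  intro q hq hqB
  simp only [Set.mem_union, Set.mem_singleton_iff, Set.mem_ofPred_eq, not_or] at hqB
  obtain ⟨hqB, hqp, hqd⟩ := hqB
  have hur : Algebra.IsUnramifiedIn (𝓞 M) (span {(q : ℤ)}) :=
    (not_dvd_discr_iff_isUnramifiedIn M (𝓞 M) (Nat.prime_iff_prime_int.mp hq)).mp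
      (fun h => hqd (by simpa using Int.natAbs_dvd_natAbs.mpr h))
  have := isPrime_span_natCast hq
  obtain ⟨⟨Q, hQ⟩⟩ := (inferInstance : Nonempty ((span {(q : ℤ)}).primesOver (𝓞 M)))
  have := isMaximal_of_mem_primesOver hq hQ
  obtain ⟨σ, hσ⟩ := IsArithFrobAt.exists_of_isInvariant ℤ Gal(M/ℚ) Q
  have hχ : ((χ σ : (ZMod p)ˣ) : ZMod p) = q :=
    autToPow_eq_of_isArithFrobAt hq (Ne.symm hqp) hζ hQ hσ
  have hterm : ∀ d ∈ n.divisors, c d * idealCount (E d) q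
      = ((ArithmeticFunction.moebius (n / d) : ℤ) : ℝ) * (if σ ∈ H d then 1 else 0) := by
    intro d hd
    have := hE d
    have hone : AlgEquiv.restrictNormalHom (E d) σ = 1 ↔ σ ∈ H d :=
      restrictNormalHom_fixedField_eq_one_iff (H d)
    rw [idealCount_prime_eq hq (isUnramifiedIn_of_algebra hur) (under_mem_primesOver hQ)
      (isArithFrobAt_restrictNormalHom hσ)]
    simp only [hone]
    split_ifs with hσd
    · have h1 : (Module.finrank ℚ (E d) : ℝ) * d = Module.finrank ℚ M := by
        exact_mod_cast hdeg d hd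
      simp only [c]
      rw [mul_assoc, mul_one, ← h1]
      have h2 : (Module.finrank ℚ (E d) : ℝ) * d ≠ 0 := by rw [h1]; exact hD.ne'
      have := left_ne_zero_of_mul h2
      have := right_ne_zero_of_mul h2
      field_simp
    · simp
  rw [Finset.sum_congr rfl hterm]
  -- If σ is trivial on K, the sum is the indicator of χ σ having order n, excluded by `hcon`;
  -- otherwise σ lies in no H_d.
  by_cases hf : f σ = 1
  · have hiff (d : ℕ) : σ ∈ H d ↔ orderOf (χ σ) ∣ d := by
      rw [hmemH, orderOf_dvd_iff_pow_eq_one]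
      exact and_iff_right hf
    simp only [hiff]
    rw [sum_moebius_mul_ite_dvd hn, if_neg]
    intro hno
    refine hcon q hq hqB ?_ (χ σ) hχ hno.symm
    refine splitsIn_of_isArithFrobAt_one hq (isUnramifiedIn_of_algebra (M := M) hur)
      (under_mem_primesOver hQ) ?_
    have := isArithFrobAt_restrictNormalHom (L := K) hσ
    rwa [show AlgEquiv.restrictNormalHom K σ = 1 from hf] at this
  · refine Finset.sum_eq_zero fun d _ => ?_
    rw [if_neg (fun h => hf ((hmemH d σ).mp h).1), mul_zero]

end NumberField

/-! ### Combining the two choices. -/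

theorem mainTheorem8 (n : ℕ) (hn : 2 ≤ n) (hn_even : Even n)
    (ℓ : ℕ) [Fact ℓ.Prime]
    (K : Type*) [Field K] [NumberField K] [IsGalois ℚ K]
    (t N : ℕ) (ht : 0 < t) (hN : 0 < N) :
    ∃ p q : ℕ, p.Prime ∧ q.Prime ∧
      (p ≠ q ∧ p ≠ ℓ ∧ q ≠ ℓ) ∧
      N < p ∧
      SplitsIn q K ∧
      (∃ u : (ZMod p)ˣ, (u : ZMod p) = (q : ZMod p) ∧ orderOf u = n) ∧
      ∀ (F : Type*) [Field F] [Finite F] [CharP F ℓ],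
        (∃ g : GSp (Fin (n / 2)) F, orderOf g = p) →
          Nonempty (GaloisField ℓ t →+* F) := by
  have hdeg : 0 < Module.finrank ℚ K := Module.finrank_pos
  -- The order of ℓ modulo p is to be a multiple of this: t·n! yields the subfield, and since the
  -- order divides p - 1, n[K:ℚ] permits the choice of q and N ensures p > N.
  have hm : t * n.factorial * (n * Module.finrank ℚ K) * N ≠ 0 := by positivity
  obtain ⟨p, hp, hpℓ, hord⟩ := exists_prime_dvd_orderOf ℓ _ (Fact.out : ℓ.Prime).two_le hm
  have := Fact.mk hp
  have hp1 : orderOf (ℓ : ZMod p) ∣ p - 1 := by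
    refine orderOf_dvd_of_pow_eq_one (ZMod.pow_card_sub_one_eq_one ?_)
    rwa [Ne, ZMod.natCast_eq_zero_iff]
  have hNp : N < p := by
    have := Nat.le_of_dvd (Nat.sub_pos_of_lt hp.one_lt)
      (((dvd_mul_left N _).trans hord).trans hp1)
    have := hp.two_le
    omega
  have hnK : n * Module.finrank ℚ K ∣ p - 1 :=
    (((dvd_mul_left _ _).trans (dvd_mul_right _ N)).trans hord).trans hp1
  obtain ⟨q, hq, hqB, hsplit, hu⟩ := NumberField.exists_prime_splitsIn_orderOf K hp
    (by omega) hnK (B := {p, ℓ}) (Set.toFinite _)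
  simp only [Set.mem_insert_iff, Set.mem_singleton_iff, not_or] at hqB
  refine ⟨p, q, hp, hq, ⟨Ne.symm hqB.1, ?_, hqB.2⟩, hNp, hsplit, hu, ?_⟩
  · rintro rfl
    exact hpℓ dvd_rfl
  · rintro F _ _ _ ⟨g, hg⟩
    refine nonempty_ringHom_galoisField_of_orderOf_GSp ht.ne' hp hpℓ ?_ g hg
    have hcard : Fintype.card (Fin (n / 2) ⊕ Fin (n / 2)) = n := by
      rw [Fintype.card_sum, Fintype.card_fin]
      obtain ⟨k, rfl⟩ := hn_even
      omega
    rw [hcard]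
    exact ((dvd_mul_right _ _).trans (dvd_mul_right _ N)).trans hord
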